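/- All topological groups are Hausdorff and need not be abelian. For a topological group $(X,\tau)$ let $bX$ be its Bohr compactification, that is, a compact group together with a continuous homomorphism from $X$ onto a dense subgroup of $bX$ through which every continuous homomorphism from $X$ into a compact group factors continuously. Let $X^+=(X,\tau^+)$, where $\tau^+$ is the topology on $X$ induced from $bX$. The group $X$ is called MAP (maximally almost periodic) if $X^+$ is Hausdorff. A MAP group $X$ has the Schur property if $X$ and $X^+$ have the same convergent sequences; $\mathfrak{RS}$ denotes the class of all MAP groups with the Schur property. For a topological group $(X,\tau)$ let $\mathbf{s}(X)=(X,\tau_S)$, where $\tau_S$ is the finest Hausdorff group topology on $X$ in which all sequences converging to the unit in $(X,\tau)$ converge to the unit. The group $X$ is an $s$-group if $\mathbf{s}(X)=X$, i.e. $\tau_S=\tau$; $\mathbf{S}$ denotes the class of all $s$-groups. Let $X$ and $Y$ be MAP groups. (1) $X\in\mathfrak{RS}$ if and only if $\mathbf{s}(X^+)=\mathbf{s}(X)$. (2) $X\in\mathbf{S}\cap\mathfrak{RS}$ if and only if $\mathbf{s}(X^+)=X$. (3) $\mathbf{S}\cap\mathfrak{RS}\subsetneq\mathbf{S}$ and $\mathbf{S}\cap\mathfrak{RS}\subsetneq\mathfrak{RS}$.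 Moreover, the first inclusion is strict already among MAP groups: there is a MAP $s$-group without the Schur property. (4) If $X\in\mathbf{S}$, $Y\in\mathfrak{RS}$, and $\phi:X\to Y$ is a homomorphism which is continuous as a map $X^+\to Y^+$, then $\phi:X\to Y$ is continuous. -/

import Mathlib

open Filter Topology

universe u v

/-- A Hausdorff topological group, bundled with its underlying type: an object of `TG`. -/
structure HausGrp : Type (u + 1) where
  /-- the underlying type -/
  carrier : Type u
  [group : Group carrier]
  [topologicalSpace : TopologicalSpace carrier]
  [isTopologicalGroup : IsTopologicalGroup carrier]
  [t2Space : T2Space carrier]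

namespace HausGrp

instance : CoeSort HausGrp.{u} (Type u) := ⟨HausGrp.carrier⟩

attribute [instance] HausGrp.group HausGrp.topologicalSpace HausGrp.isTopologicalGroup
  HausGrp.t2Space

/-- The topology of a Hausdorff topological group, as a member of the lattice of group topologies
of the underlying group. -/
def top (X : HausGrp.{u}) : GroupTopology X where
  toTopologicalSpace := X.topologicalSpace
  toIsTopologicalGroup := X.isTopologicalGroup

end HausGrp

section GroupTopologies

variable {G : Type u} [Group G]

/-- `i : G → B` exhibits the compact Hausdorff group `B` as the Bohr compactification of the
topological group `(G, t)`: `i` is a continuous homomorphism with dense range through which every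
continuous homomorphism from `G` into a compact Hausdorff group factors continuously. -/
structure IsBohrCompactification (t : GroupTopology G) {B : Type u} [Group B] [TopologicalSpace B]
    [IsTopologicalGroup B] [CompactSpace B] [T2Space B] (i : G →* B) : Prop where
  continuous : Continuous[t.toTopologicalSpace, _] i
  denseRange : DenseRange i
  exists_lift : ∀ (C : Type u) [Group C] [TopologicalSpace C] [IsTopologicalGroup C]
    [CompactSpace C] [T2Space C] (p : G →* C), Continuous[t.toTopologicalSpace, _] p →
      ∃ j : B →* C, Continuous j ∧ ∀ x, p x = j (i x)

/-- The Bohr modification `t⁺` of a group topology `t`: the coarsest group topology making every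
`t`-continuous homomorphism into a compact Hausdorff group continuous. It is the
topology induced on `G` by the Bohr compactification of `(G, t)`, see
`IsBohrCompactification.bohr_eq_induced`. -/
def bohr (t : GroupTopology G) : GroupTopology G :=
  sInf {s | ∃ (C : Type u) (_ : Group C) (_ : TopologicalSpace C) (_ : IsTopologicalGroup C)
    (_ : CompactSpace C) (_ : T2Space C) (p : G →* C), Continuous[t.toTopologicalSpace, _] p ∧
      s.toTopologicalSpace = TopologicalSpace.induced p inferInstance}

theorem IsBohrCompactification.bohr_eq_induced {t : GroupTopology G} {B : Type u} [Group B]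
    [TopologicalSpace B] [IsTopologicalGroup B] [CompactSpace B] [T2Space B] {i : G →* B}
    (hi : IsBohrCompactification t i) :
    (bohr t).toTopologicalSpace = TopologicalSpace.induced i inferInstance := by
  have key : bohr t = ⟨TopologicalSpace.induced i inferInstance, topologicalGroup_induced i⟩ := by
    apply le_antisymm
    · exact sInf_le ⟨B, inferInstance, inferInstance, inferInstance, inferInstance, inferInstance,
        i, hi.continuous, rfl⟩
    · refine le_sInf ?_
      rintro s ⟨C, _, _, _, _, _, p, hp, hs⟩
      obtain ⟨j, hj, hpj⟩ := hi.exists_lift C p hp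
      rw [← GroupTopology.toTopologicalSpace_le, hs]
      have hpj' : (p : G → C) = j ∘ i := funext hpj
      rw [hpj', ← induced_compose]
      exact induced_mono hj.le_induced
  rw [key]

/-- The sequences in `(G, t)` converging to some point. -/
def convergentSeqs (t : GroupTopology G) : Set (ℕ → G) :=
  {a | ∃ x, Tendsto a atTop (@nhds G t.toTopologicalSpace x)}

/-- The sequences in `(G, t)` converging to the unit. -/
def nullSeqs (t : GroupTopology G) : Set (ℕ → G) :=
  {a | Tendsto a atTop (@nhds G t.toTopologicalSpace 1)}

/-- The Hausdorff group topologies on `G` in which all the sequences from `S` converge to the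
unit. -/
def hausdorffTopologiesWith (S : Set (ℕ → G)) : Set (GroupTopology G) :=
  {s | @T2Space G s.toTopologicalSpace ∧ S ⊆ nullSeqs s}

/-- The topology `τ_S` of the `s`-modification of `(G, t)`: the finest Hausdorff group topology in
which all `t`-null sequences converge to the unit. (In the lattice of topologies, finer
is smaller; the infimum is attained by `isLeast_sMod`.) -/
def sMod (t : GroupTopology G) : GroupTopology G :=
  sInf (hausdorffTopologiesWith (nullSeqs t))

theorem isLeast_sMod (t : GroupTopology G) (ht : @T2Space G t.toTopologicalSpace) :
    IsLeast (hausdorffTopologiesWith (nullSeqs t)) (sMod t) := by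
  refine ⟨⟨?_, ?_⟩, fun s hs => sInf_le hs⟩
  · have h : sMod t ≤ t := sInf_le ⟨ht, subset_rfl⟩
    exact @T2Space.of_injective_continuous G G (sMod t).toTopologicalSpace t.toTopologicalSpace ht
      id Function.injective_id (continuous_id_iff_le.2 h)
  · intro a ha
    change Tendsto a atTop (@nhds G (sInf (GroupTopology.toTopologicalSpace '' _)) 1)
    rw [nhds_sInf]
    refine tendsto_iInf.2 fun T => tendsto_iInf.2 ?_
    rintro ⟨s, hs, rfl⟩
    exact hs.2 ha

end GroupTopologies

namespace HausGrp

/-- The class of all maximally almost periodic groups: those whose Bohr modification is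
Hausdorff. -/
def MAP : Set HausGrp.{u} := {X | @T2Space X (bohr X.top).toTopologicalSpace}

/-- The class of all `s`-groups. -/
def SGroups : Set HausGrp.{u} := {X | X.top = sMod X.top}

/-- The class of all MAP groups with the Schur property: `X` and `X⁺` have the same convergent
sequences. -/
def RS : Set HausGrp.{u} := {X | X ∈ MAP ∧ convergentSeqs X.top = convergentSeqs (bohr X.top)}

end HausGrp

/-!
The topology of the `s`-modification `sMod t` has the same null sequences as `t`, and it depends
only on them; so `sMod s = sMod t` exactly when `s` and `t` have the same null sequences
(`sMod_eq_sMod_iff`). As `bohr t` is coarser than `t`, for a MAP group the Schur property also says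
that `t` and `bohr t` have the same null sequences (`HausGrp.mem_RS_iff`). This gives the two
characterizations. It also shows that a homomorphism from an `s`-group to a group with the Schur
property is sequentially continuous if it is continuous for the Bohr modifications, and a
sequentially continuous homomorphism on an `s`-group is continuous (`continuous_of_nullSeqs`).

The strictness of the inclusions rests on two examples.

* The product of the groups `Perm (Fin (n + 3))`, taken with the discrete topology, is an `s`-group,
  and it is MAP because the product topology is compact. Let `p` be a homomorphism of it into a
  compact group. By pigeonhole, for large `n` the images of two distinct transpositions `(0 i)`,
  `(0 j)` of the `n`-th factor are close to each other, so `p` maps the 3-cycle `(0 i) (0 j)` close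
  to the unit. All 3-cycles in the factor are conjugate, and a compact group has arbitrarily small
  conjugation-invariant neighbourhoods of the unit. Hence any choice of 3-cycles, one in each
  factor, is a null sequence of the Bohr modification (`tendsto_map_permProdThreeCycle`), though not
  of the discrete topology.
* The integers with their Bohr topology embed into a compact group, so the Bohr modification changes
  nothing and the Schur property is trivial. Null sequences are eventually constant, because
  integrating the characters `z ↦ z ^ a n` over the circle gives `0` unless `a n = 0`
  (`eventually_eq_zero_of_tendsto_zpow`). So the `s`-modification is discrete, while an infinite
  subgroup of a compact group is not (`inducedGroupTopology_ne_bot`).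
-/

/-! ### Null sequences, the `s`-modification and the Bohr modification -/

section GroupTopologies

variable {G : Type u} [Group G]

theorem nullSeqs_mono {s t : GroupTopology G} (h : s ≤ t) : nullSeqs s ⊆ nullSeqs t :=
  fun _ ha => ha.mono_right (nhds_mono (GroupTopology.toTopologicalSpace_le.2 h))

theorem tendsto_nhds_iff_mem_nullSeqs (t : GroupTopology G) (a : ℕ → G) (x : G) :
    Tendsto a atTop (@nhds G t.toTopologicalSpace x) ↔ (fun n => x⁻¹ * a n) ∈ nullSeqs t := by
  let := t.toTopologicalSpace
  have := t.toIsTopologicalGroup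
  constructor
  · intro h
    simpa [nullSeqs] using h.const_mul x⁻¹
  · intro (h : Tendsto (fun n => x⁻¹ * a n) atTop (𝓝 1))
    simpa using h.const_mul x

/-- A sequence null in the coarser Hausdorff topology `t` and convergent in `s` can only have the
unit as its `s`-limit, so the convergent sequences determine the null ones. -/
theorem convergentSeqs_eq_iff_nullSeqs_eq {s t : GroupTopology G} (h : s ≤ t)
    (ht : @T2Space G t.toTopologicalSpace) :
    convergentSeqs s = convergentSeqs t ↔ nullSeqs s = nullSeqs t := by
  constructor
  · intro hst
    refine (nullSeqs_mono h).antisymm fun a ha => ?_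
    obtain ⟨x, hx⟩ : a ∈ convergentSeqs s := hst ▸ ⟨1, ha⟩
    have hx' := hx.mono_right (nhds_mono (GroupTopology.toTopologicalSpace_le.2 h))
    obtain rfl : x = 1 := @tendsto_nhds_unique _ _ t.toTopologicalSpace ht _ _ _ _ _ hx' ha
    exact hx
  · intro hst
    ext a
    simp only [convergentSeqs, Set.mem_ofPred_eq, tendsto_nhds_iff_mem_nullSeqs, hst]

theorem sMod_le (t : GroupTopology G) (ht : @T2Space G t.toTopologicalSpace) : sMod t ≤ t :=
  (isLeast_sMod t ht).2 ⟨ht, subset_rfl⟩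

theorem nullSeqs_sMod (t : GroupTopology G) (ht : @T2Space G t.toTopologicalSpace) :
    nullSeqs (sMod t) = nullSeqs t :=
  (nullSeqs_mono (sMod_le t ht)).antisymm (isLeast_sMod t ht).1.2

theorem sMod_eq_sMod_iff {s t : GroupTopology G} (hs : @T2Space G s.toTopologicalSpace)
    (ht : @T2Space G t.toTopologicalSpace) : sMod s = sMod t ↔ nullSeqs s = nullSeqs t := by
  refine ⟨fun h => ?_, fun h => by rw [sMod, sMod, h]⟩
  rw [← nullSeqs_sMod s hs, h, nullSeqs_sMod t ht]

theorem le_bohr (t : GroupTopology G) : t ≤ bohr t := by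
  refine le_sInf ?_
  rintro s ⟨C, _, _, _, _, _, p, hp, hs⟩
  rw [← GroupTopology.toTopologicalSpace_le, hs]
  exact hp.le_induced

/-- The group topology induced by a homomorphism into a topological group. -/
def inducedGroupTopology {H : Type v} [Group H] [TopologicalSpace H] [IsTopologicalGroup H]
    (p : G →* H) : GroupTopology G where
  toTopologicalSpace := TopologicalSpace.induced p inferInstance
  toIsTopologicalGroup := topologicalGroup_induced p

theorem t2Space_inducedGroupTopology {H : Type v} [Group H] [TopologicalSpace H]
    [IsTopologicalGroup H] [T2Space H] {p : G →* H} (hp : Function.Injective p) :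
    @T2Space G (inducedGroupTopology p).toTopologicalSpace :=
  letI := (inducedGroupTopology p).toTopologicalSpace
  T2Space.of_injective_continuous hp continuous_induced_dom

theorem bohr_le_inducedGroupTopology {t : GroupTopology G} {C : Type u} [Group C]
    [TopologicalSpace C] [IsTopologicalGroup C] [CompactSpace C] [T2Space C] {p : G →* C}
    (hp : Continuous[t.toTopologicalSpace, _] p) : bohr t ≤ inducedGroupTopology p :=
  sInf_le ⟨C, _, _, inferInstance, inferInstance, inferInstance, p, hp, rfl⟩

theorem t2Space_of_le {s t : GroupTopology G} (h : s ≤ t) (ht : @T2Space G t.toTopologicalSpace) :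
    @T2Space G s.toTopologicalSpace :=
  @T2Space.of_injective_continuous G G s.toTopologicalSpace t.toTopologicalSpace ht
    id Function.injective_id (continuous_id_iff_le.2 (GroupTopology.toTopologicalSpace_le.2 h))

theorem bohr_inducedGroupTopology {C : Type u} [Group C] [TopologicalSpace C]
    [IsTopologicalGroup C] [CompactSpace C] [T2Space C] (p : G →* C) :
    bohr (inducedGroupTopology p) = inducedGroupTopology p :=
  (bohr_le_inducedGroupTopology continuous_induced_dom).antisymm (le_bohr _)

theorem mem_nullSeqs_inducedGroupTopology {H : Type v} [Group H] [TopologicalSpace H]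
    [IsTopologicalGroup H] {p : G →* H} {a : ℕ → G} :
    a ∈ nullSeqs (inducedGroupTopology p) ↔ Tendsto (fun n => p (a n)) atTop (𝓝 1) := by
  change Tendsto a atTop (@nhds G (TopologicalSpace.induced p _) 1) ↔ _
  rw [nhds_induced, tendsto_comap_iff, map_one]
  rfl

theorem mem_nullSeqs_bot {a : ℕ → G} :
    a ∈ nullSeqs (⊥ : GroupTopology G) ↔ ∀ᶠ n in atTop, a n = 1 := by
  change Tendsto a atTop (@nhds G ⊥ 1) ↔ _
  rw [@nhds_discrete G ⊥ (discreteTopology_bot G), tendsto_pure]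

theorem mem_nullSeqs_bohr {t : GroupTopology G} {a : ℕ → G}
    (h : ∀ (C : Type u) [Group C] [TopologicalSpace C] [IsTopologicalGroup C]
      [CompactSpace C] [T2Space C] (p : G →* C), Tendsto (fun n => p (a n)) atTop (𝓝 1)) :
    a ∈ nullSeqs (bohr t) := by
  change Tendsto a atTop (@nhds G (sInf (GroupTopology.toTopologicalSpace '' _)) 1)
  rw [nhds_sInf]
  refine tendsto_iInf.2 fun T => tendsto_iInf.2 ?_
  rintro ⟨s, ⟨C, _, _, _, _, _, p, hp, hs⟩, rfl⟩
  rw [hs, nhds_induced, tendsto_comap_iff, map_one]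
  exact h C p

/-- The topology of an `s`-group is the finest one with its null sequences, in particular finer than
the one induced by a sequentially continuous homomorphism. -/
theorem continuous_of_nullSeqs {t : GroupTopology G} (ht : @T2Space G t.toTopologicalSpace)
    (hs : t = sMod t) {H : Type v} [Group H] {r : GroupTopology H} (φ : G →* H)
    (h : ∀ a ∈ nullSeqs t, φ ∘ a ∈ nullSeqs r) :
    Continuous[t.toTopologicalSpace, r.toTopologicalSpace] φ := by
  let := r.toTopologicalSpace
  have := r.toIsTopologicalGroup
  -- The infimum with `t` keeps the comparison topology Hausdorff when `φ` is not injective.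
  have hmem : t ⊓ inducedGroupTopology φ ∈ hausdorffTopologiesWith (nullSeqs t) := by
    refine ⟨t2Space_of_le inf_le_left ht, fun a ha => ?_⟩
    change Tendsto a atTop (@nhds G (t.toTopologicalSpace ⊓ _) 1)
    rw [nhds_inf, tendsto_inf]
    refine ⟨ha, ?_⟩
    exact mem_nullSeqs_inducedGroupTopology.2 (h a ha)
  have hle : t ≤ inducedGroupTopology φ :=
    hs.le.trans (((isLeast_sMod t ht).2 hmem).trans inf_le_right)
  exact continuous_iff_le_induced.2 (GroupTopology.toTopologicalSpace_le.2 hle)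

end GroupTopologies

namespace HausGrp

theorem mem_RS_iff {X : HausGrp.{u}} (hX : X ∈ MAP) :
    X ∈ RS ↔ nullSeqs X.top = nullSeqs (bohr X.top) :=
  (and_iff_right hX).trans (convergentSeqs_eq_iff_nullSeqs_eq (le_bohr _) hX)

theorem mem_RS_iff_sMod_eq {X : HausGrp.{u}} (hX : X ∈ MAP) :
    X ∈ RS ↔ sMod (bohr X.top) = sMod X.top := by
  rw [mem_RS_iff hX, sMod_eq_sMod_iff hX X.t2Space, eq_comm]

theorem mem_SGroups_inter_RS_iff {X : HausGrp.{u}} (hX : X ∈ MAP) :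
    X ∈ SGroups ∩ RS ↔ sMod (bohr X.top) = X.top := by
  constructor
  · rintro ⟨hS, hR⟩
    exact ((mem_RS_iff_sMod_eq hX).1 hR).trans (Eq.symm hS)
  · intro h
    have hR : X ∈ RS := by
      rw [mem_RS_iff hX, ← nullSeqs_sMod _ hX, h]
    exact ⟨h.symm.trans ((mem_RS_iff_sMod_eq hX).1 hR), hR⟩

end HausGrp

/-! ### Small quotients and conjugates in compact groups -/

section CompactGroups

variable {C : Type u} [Group C] [TopologicalSpace C] [IsTopologicalGroup C] [CompactSpace C]

/-- A neighbourhood of the unit contains a quotient of two members of any large enough family: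
finitely many translates of a smaller neighbourhood cover the group. -/
theorem exists_card_forall_inv_mul_mem {W : Set C} (hW : W ∈ 𝓝 (1 : C)) :
    ∃ k : ℕ, ∀ f : Fin (k + 1) → C, ∃ i j, i ≠ j ∧ (f i)⁻¹ * f j ∈ W := by
  obtain ⟨V, hV, hVW⟩ : ∃ V ∈ 𝓝 (1 : C), ∀ v ∈ V, ∀ w ∈ V, v⁻¹ * w ∈ W := by
    have h : Tendsto (fun p : C × C => p.1⁻¹ * p.2) (𝓝 1 ×ˢ 𝓝 1) (𝓝 1) := by
      have : ContinuousAt (fun p : C × C => p.1⁻¹ * p.2) (1, 1) := by fun_prop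
      simpa [ContinuousAt, nhds_prod_eq] using this
    obtain ⟨V, hV, hVW⟩ := Filter.mem_prod_same_iff.1 (h hW)
    exact ⟨V, hV, fun v hv w hw => hVW (Set.mk_mem_prod hv hw)⟩
  obtain ⟨t, ht⟩ := compact_covered_by_mul_left_translates (isCompact_univ (X := C))
    ⟨1, mem_interior_iff_mem_nhds.2 hV⟩
  refine ⟨t.card, fun f => ?_⟩
  have hf : ∀ i, ∃ g ∈ t, g * f i ∈ V := fun i => by simpa using ht (Set.mem_univ (f i))
  choose g hgt hg using hf
  obtain ⟨i, -, j, -, hij, hgij⟩ := Finset.exists_ne_map_eq_of_card_lt_of_maps_to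
    (s := Finset.univ) (t := t) (f := g) (by simp) (fun i _ => hgt i)
  refine ⟨i, j, hij, ?_⟩
  have := hVW _ (hg i) _ (hg j)
  rwa [hgij, mul_inv_rev, mul_assoc, inv_mul_cancel_left] at this

theorem eventually_forall_conj_mem {U : Set C} (hU : U ∈ 𝓝 (1 : C)) :
    ∀ᶠ w in 𝓝 (1 : C), ∀ g : C, g * w * g⁻¹ ∈ U := by
  have h := (isCompact_univ (X := C)).eventually_forall_of_forall_eventually
    (x₀ := (1 : C)) (P := fun w g => g * w * g⁻¹ ∈ U) (fun g _ => by
      have : ContinuousAt (fun p : C × C => p.2 * p.1 * p.2⁻¹) (1, g) := by fun_prop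
      exact this (by simpa using hU))
  simpa using h

/-- An infinite group is not discrete in the topology induced from a compact group. -/
theorem inducedGroupTopology_ne_bot {G : Type v} [Group G] [Infinite G] (p : G →* C) :
    inducedGroupTopology p ≠ ⊥ := by
  intro h
  have h1 : {(1 : G)} ∈ @nhds G (TopologicalSpace.induced p inferInstance) 1 := by
    have : TopologicalSpace.induced p inferInstance = (⊥ : TopologicalSpace G) :=
      congrArg GroupTopology.toTopologicalSpace h
    rw [this, @nhds_discrete G ⊥ (discreteTopology_bot G)]
    exact Filter.mem_pure.2 (Set.mem_singleton (1 : G))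
  rw [nhds_induced, map_one] at h1
  obtain ⟨W, hW, hWp⟩ := h1
  obtain ⟨k, hk⟩ := exists_card_forall_inv_mul_mem hW
  obtain ⟨i, j, hij, hmem⟩ := hk fun i => p (Infinite.natEmbedding G i)
  rw [← map_inv, ← map_mul] at hmem
  have : (Infinite.natEmbedding G i)⁻¹ * Infinite.natEmbedding G j = 1 := hWp hmem
  rw [inv_mul_eq_one] at this
  exact hij (Fin.ext ((Infinite.natEmbedding G).injective this))

end CompactGroups

/-! ### A discrete group without the Schur property -/

section PermProd

open Equiv

/-- The product of the groups of permutations of `n + 3` points, `n : ℕ`. -/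
abbrev PermProd : Type u := ∀ n : ULift.{u} ℕ, Perm (Fin (n.down + 3))

/-- The 3-cycle `(0 2 1)` in the `n`-th factor of `PermProd`. -/
def permProdThreeCycle (n : ℕ) : PermProd.{u} :=
  Pi.mulSingle (ULift.up n) (swap 0 1 * swap 0 2)

theorem isThreeCycle_swap_zero_one_mul_swap_zero_two (n : ℕ) :
    (swap 0 1 * swap 0 2 : Perm (Fin (n + 3))).IsThreeCycle := by
  have h2 : 2 % (n + 3) = 2 := Nat.mod_eq_of_lt (by omega)
  apply Perm.isThreeCycle_swap_mul_swap_same <;> simp [Fin.ext_iff, h2]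

theorem isConj_threeCycles {n : ℕ} {a b : Fin (n + 3)} (ha : a ≠ 0) (hb : b ≠ 0) (hab : a ≠ b) :
    IsConj (swap 0 a * swap 0 b) (swap 0 1 * swap 0 2) := by
  rw [Perm.isConj_iff_cycleType_eq,
    (Perm.isThreeCycle_swap_mul_swap_same ha.symm hb.symm hab).cycleType,
    (isThreeCycle_swap_zero_one_mul_swap_zero_two n).cycleType]

theorem permProdThreeCycle_ne_one (n : ℕ) : permProdThreeCycle.{u} n ≠ 1 := by
  rw [permProdThreeCycle, Ne, Pi.mulSingle_eq_one_iff]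
  exact (isThreeCycle_swap_zero_one_mul_swap_zero_two n).ne_one

/-- Among the many transpositions `(0 i)` of the `n`-th factor, two have images whose quotient is
close to the unit. That quotient is the image of a 3-cycle, and all 3-cycles are conjugate, while
closeness to the unit in a compact group is uniform over conjugates. -/
theorem tendsto_map_permProdThreeCycle {C : Type u} [Group C] [TopologicalSpace C]
    [IsTopologicalGroup C] [CompactSpace C] (p : PermProd.{u} →* C) :
    Tendsto (fun n => p (permProdThreeCycle n)) atTop (𝓝 1) := by
  intro U hU
  obtain ⟨k, hk⟩ := exists_card_forall_inv_mul_mem (eventually_forall_conj_mem hU)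
  refine (eventually_ge_atTop k).mono fun n hn => ?_
  let q : Perm (Fin (n + 3)) →* C :=
    p.comp (MonoidHom.mulSingle (fun n : ULift.{u} ℕ => Perm (Fin (n.down + 3))) (ULift.up n))
  let e : Fin (k + 1) → Fin (n + 3) := fun i => (i.castLE (by omega) : Fin (n + 2)).succ
  obtain ⟨i, j, hij, h⟩ := hk fun i => q (swap 0 (e i))
  have he : ∀ i, e i ≠ 0 := fun i => Fin.succ_ne_zero _
  have heij : e i ≠ e j := by simpa [e] using hij
  rw [← map_inv, ← map_mul, swap_inv] at h
  obtain ⟨c, hc⟩ := isConj_iff.1 (isConj_threeCycles (he i) (he j) heij)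
  have := h (q c)
  rw [← map_inv, ← map_mul, ← map_mul, hc] at this
  exact this

/-- `PermProd` with the discrete topology. -/
def discretePermProd : HausGrp.{u} :=
  letI : TopologicalSpace PermProd.{u} := ⊥
  haveI : DiscreteTopology PermProd.{u} := ⟨rfl⟩
  ⟨PermProd.{u}⟩

theorem discretePermProd_mem_SGroups : discretePermProd.{u} ∈ HausGrp.SGroups :=
  le_antisymm (bot_le (a := sMod discretePermProd.{u}.top)) (sMod_le _ discretePermProd.t2Space)

theorem discretePermProd_mem_MAP : discretePermProd.{u} ∈ HausGrp.MAP := by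
  -- Tychonoff: the product topology with discrete finite factors is compact.
  let (n : ULift.{u} ℕ) : TopologicalSpace (Perm (Fin (n.down + 3))) := ⊥
  have (n : ULift.{u} ℕ) : DiscreteTopology (Perm (Fin (n.down + 3))) := ⟨rfl⟩
  exact t2Space_of_le
    (bohr_le_inducedGroupTopology (t := discretePermProd.{u}.top) (C := PermProd.{u})
      (p := MonoidHom.id PermProd.{u}) continuous_bot)
    (t2Space_inducedGroupTopology (p := MonoidHom.id PermProd.{u}) Function.injective_id)

theorem discretePermProd_notMem_RS : discretePermProd.{u} ∉ HausGrp.RS := by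
  rw [HausGrp.mem_RS_iff discretePermProd_mem_MAP]
  intro h
  have hmem : permProdThreeCycle.{u} ∈ nullSeqs discretePermProd.{u}.top := by
    rw [h]
    exact mem_nullSeqs_bohr fun C _ _ _ _ _ p => tendsto_map_permProdThreeCycle p
  obtain ⟨n, hn⟩ := (mem_nullSeqs_bot.1 hmem).exists
  exact permProdThreeCycle_ne_one n hn

end PermProd

/-! ### A precompact group that is not an `s`-group -/

section BohrInt

open MeasureTheory AddCircle

/-- By dominated convergence the integrals of the characters `z ↦ z ^ a n` tend to `1`, and such an
integral vanishes unless `a n = 0`. -/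
theorem eventually_eq_zero_of_tendsto_zpow {a : ℕ → ℤ}
    (h : ∀ z : Circle, Tendsto (fun n => z ^ a n) atTop (𝓝 1)) : ∀ᶠ n in atTop, a n = 0 := by
  have hint : ∀ m : ℤ, ∫ x : UnitAddCircle, fourier m x ∂haarAddCircle
      = if m = 0 then 1 else 0 := fun m => by
    have := congrFun (fourierCoeff_fourier (T := 1) m) 0
    simpa [fourierCoeff, Pi.single_apply, eq_comm] using this
  have hlim : Tendsto (fun n => ∫ x : UnitAddCircle, fourier (a n) x ∂haarAddCircle) atTop
      (𝓝 (∫ _ : UnitAddCircle, (1 : ℂ) ∂haarAddCircle)) := by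
    refine tendsto_integral_of_dominated_convergence (fun _ => 1)
      (fun n => (fourier (a n)).continuous.aestronglyMeasurable) (integrable_const _)
      (fun n => .of_forall fun x => by simp [fourier_apply, Circle.norm_coe])
      (.of_forall fun x => ?_)
    have : Tendsto (fun n => ((toCircle x ^ a n : Circle) : ℂ)) atTop (𝓝 ((1 : Circle) : ℂ)) :=
      (continuous_subtype_val.tendsto _).comp (h (toCircle x))
    simpa [fourier_apply, toCircle_zsmul] using this
  simp only [hint, integral_const, probReal_univ, one_smul] at hlim
  filter_upwards [hlim.eventually_ne one_ne_zero] with n hn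
  by_contra h0
  simp [h0] at hn

/-- The homomorphism `n ↦ (z ↦ z ^ n)` embedding the integers into a power of the circle. -/
noncomputable def intToCircles : ULift.{u} (Multiplicative ℤ) →* (ULift.{u} Circle → Circle) where
  toFun n z := z.down ^ n.down.toAdd
  map_one' := by ext; simp
  map_mul' m n := by ext; simp [zpow_add]

theorem eventually_eq_one_of_tendsto_intToCircles {a : ℕ → ULift.{u} (Multiplicative ℤ)}
    (h : Tendsto (fun n => intToCircles (a n)) atTop (𝓝 1)) : ∀ᶠ n in atTop, a n = 1 := by
  have := eventually_eq_zero_of_tendsto_zpow (a := fun n => (a n).down.toAdd)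
    fun z => tendsto_pi_nhds.1 h (ULift.up z)
  filter_upwards [this] with n hn
  exact ULift.ext _ _ (Multiplicative.toAdd.injective hn)

theorem intToCircles_injective : Function.Injective intToCircles.{u} := by
  refine (injective_iff_map_eq_one _).2 fun x hx => ?_
  obtain ⟨n, hn⟩ := (eventually_eq_one_of_tendsto_intToCircles (a := fun _ => x)
    (by simp [hx])).exists
  exact hn

/-- The integers with the topology of pointwise convergence of the characters `z ↦ z ^ n` on the
circle, that is, the Bohr topology of the discrete group of integers. -/
noncomputable def bohrInt : HausGrp.{u} :=
  letI := (inducedGroupTopology intToCircles.{u}).toTopologicalSpace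
  haveI := (inducedGroupTopology intToCircles.{u}).toIsTopologicalGroup
  haveI := t2Space_inducedGroupTopology intToCircles_injective.{u}
  ⟨ULift.{u} (Multiplicative ℤ)⟩

theorem bohr_bohrInt : bohr bohrInt.{u}.top = bohrInt.top :=
  bohr_inducedGroupTopology intToCircles

theorem bohrInt_mem_RS : bohrInt.{u} ∈ HausGrp.RS := by
  have hM : bohrInt.{u} ∈ HausGrp.MAP := by
    rw [HausGrp.MAP, Set.mem_ofPred_eq, bohr_bohrInt]
    exact bohrInt.t2Space
  rw [HausGrp.mem_RS_iff hM, bohr_bohrInt]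

theorem bohrInt_notMem_SGroups : bohrInt.{u} ∉ HausGrp.SGroups := by
  intro (h : bohrInt.{u}.top = sMod bohrInt.top)
  refine inducedGroupTopology_ne_bot intToCircles.{u} (le_bot_iff.1 ?_)
  have hbot : @T2Space (ULift.{u} (Multiplicative ℤ)) ⊥ :=
    @DiscreteTopology.toT2Space _ ⊥ (discreteTopology_bot _)
  exact h.le.trans (sInf_le ⟨hbot, fun a ha => mem_nullSeqs_bot.2
    (eventually_eq_one_of_tendsto_intToCircles (mem_nullSeqs_inducedGroupTopology.1 ha))⟩)

end BohrInt

/-! ### The classes of `s`-groups and of groups with the Schur property -/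

theorem propositionp62 :
    -- (1)
    (∀ X : HausGrp.{u}, X ∈ HausGrp.MAP →
      (X ∈ HausGrp.RS ↔ sMod (bohr X.top) = sMod X.top)) ∧
    -- (2)
    (∀ X : HausGrp.{u}, X ∈ HausGrp.MAP →
      (X ∈ HausGrp.SGroups ∩ HausGrp.RS ↔ sMod (bohr X.top) = X.top)) ∧
    -- (3), where the first inclusion is strict even among MAP groups
    (HausGrp.SGroups.{u} ∩ HausGrp.RS ⊂ HausGrp.SGroups ∧
      HausGrp.SGroups.{u} ∩ HausGrp.RS ⊂ HausGrp.SGroups ∩ HausGrp.MAP ∧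
      HausGrp.SGroups.{u} ∩ HausGrp.RS ⊂ HausGrp.RS) ∧
    -- (4)
    (∀ (X : HausGrp.{u}) (Y : HausGrp.{v}), X ∈ HausGrp.MAP → Y ∈ HausGrp.MAP →
      X ∈ HausGrp.SGroups → Y ∈ HausGrp.RS → ∀ φ : X →* Y,
        Continuous[(bohr X.top).toTopologicalSpace, (bohr Y.top).toTopologicalSpace] φ →
          Continuous φ) := by
  refine ⟨fun X => HausGrp.mem_RS_iff_sMod_eq, fun X => HausGrp.mem_SGroups_inter_RS_iff,
    ⟨?_, ?_, ?_⟩, ?_⟩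
  · exact Set.ssubset_iff_exists.2 ⟨Set.inter_subset_left, discretePermProd,
      discretePermProd_mem_SGroups, fun h => discretePermProd_notMem_RS h.2⟩
  · exact Set.ssubset_iff_exists.2 ⟨fun _ hX => ⟨hX.1, hX.2.1⟩, discretePermProd,
      ⟨discretePermProd_mem_SGroups, discretePermProd_mem_MAP⟩,
      fun h => discretePermProd_notMem_RS h.2⟩
  · exact Set.ssubset_iff_exists.2 ⟨Set.inter_subset_right, bohrInt, bohrInt_mem_RS,
      fun h => bohrInt_notMem_SGroups h.1⟩
  · intro X Y _ hYM hX hY φ hφ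
    refine continuous_of_nullSeqs (t := X.top) (r := Y.top) X.t2Space hX φ fun a ha => ?_
    rw [(HausGrp.mem_RS_iff hYM).1 hY]
    have h1 := @Continuous.tendsto _ _ (bohr X.top).toTopologicalSpace
      (bohr Y.top).toTopologicalSpace _ hφ 1
    rw [map_one] at h1
    exact h1.comp (nullSeqs_mono (le_bohr X.top) ha)
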